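/- Setting. Let $T$ be the once-punctured torus (a torus with one boundary component), $x\in\partial T$, and let $G=\pi_1(T,x)$, the free group on $\alpha,\beta$, where $\gamma_0=\alpha\beta\alpha^{-1}\beta^{-1}$ is the class of the boundary loop. Let $M$ be an untwisted hyperbolic once-punctured torus bundle over the circle with monodromy fixing $\partial T$ pointwise, and let $h$ be the automorphism of $G$ induced by the monodromy. Thus $h(\gamma_0)=\gamma_0$, the induced matrix $h_+\in \mathrm{SL}(2,\mathbb Z)$ on $H_1(T;\mathbb Z)=\mathbb Z^2$ has trace $>2$, and $\pi_1(M)\cong G\rtimes_h\mathbb Z$. Write $\lambda,1/\lambda>0$ for the eigenvalues of $h_+$ and $(e_\lambda,e_{1/\lambda})$ for an eigenbasis of $\mathbb R^2$. A *positive cone* of a group $H$ is a subset $P$ with $PP\subset P$, $H=P\sqcup P^{-1}\sqcup\{1\}$ and $g^{-1}Pg=P$ for all $g\in H$; it defines the bi-order $a<b\iff a^{-1}b\in P$. A subgroup $C$ is *convex* if $a<g<b$ with $a,b\in C$ implies $g\in C$. A proper convex subgroup $C$ of $H$ is *maximal* if the only convex subgroups of $H$ containing $C$ are $C$ and $H$.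 A bi-order on $G$ is *standard* if every term of the lower central series of $G$ is convex. For $e\in\{\pm e_\lambda,\pm e_{1/\lambda}\}$, the set of $u\in\mathbb Z^2$ with $u\cdot e>0$ (dot product taken in the coordinates with respect to the eigenbasis) is a positive cone of $\mathbb Z^2$, preserved by $h_+$; let $\prec_e$ be the corresponding order ($u\prec_e v$ if and only if $(v-u)\cdot e>0$). Let $G_2=[G,G]$, let $p_1:G\to\mathbb Z^2$ be the abelianization map and $p_2:G_2\to G_2/[G_2,G_2]$ the quotient map. The group $G_2/[G_2,G_2]$ is $H_1(\hat T;\mathbb Z)$, where $\hat T$ is the cover of $T$ with group $G_2$; it is free abelian with basis $\mathcal B=\{\gamma_u : u\in\mathbb Z^2\}$ given by the boundary components of $\hat T$, where $\gamma_{(m,n)}=p_2(\alpha^m\beta^n\gamma_0(\alpha^m\beta^n)^{-1})$. Order $\mathcal B$ by $\gamma_u<_e\gamma_v\iff u\prec_e v$. For a non-zero $v\in G_2/[G_2,G_2]$ let $\max(v)$ be the $<_e$-largest element of $\mathcal B$ that has a non-zero coefficient in $v$. Construction. Choose $e_1,e\in\{\pm e_\lambda,\pm e_{1/\lambda}\}$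 and a positive cone $R$ of $\pi_1(M)$. Let $Q_1$ be the cone of $\mathbb Z^2$ given by $e_1$; let $Q_2$ be the set of non-zero $v\in G_2/[G_2,G_2]$ whose coefficient at $\max(v)$ is positive; let $Q_3=R\cap[G_2,G_2]$. Let $P$ be the set of all $g\in G$ such that $p_1(g)\in Q_1$, or $g\in G_2$ and $p_2(g)\in Q_2$, or $g\in Q_3$. Claim. For all these choices, $P$ is a positive cone of $G$, it is the restriction to $G$ of a positive cone of $\pi_1(M)$, and the bi-order it defines on $G$ is not standard. With respect to $P$, the group $G_2$ has no maximal convex subgroup. In fact, for $\gamma\in\mathcal B$ put $$C_\gamma=\{g\in G_2 : p_2(g)=0 \text{ or } \max(p_2(g))\le_e\gamma\}.$$ Then every $C_\gamma$ is a convex subgroup of $G_2$, $\gamma<_e\delta$ implies $C_\gamma\subsetneq C_\delta\subsetneq G_2$, and $\bigcup_{\gamma\in\mathcal B}C_\gamma=G_2$. -/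

import Mathlib

namespace PuncturedTorusBundle

/-! ### Bi-orders, given by their positive cones -/

/-- A (conjugation invariant) positive cone of a group `H`: closed under products, invariant under
conjugation, and `H` is the disjoint union of `P`, `P⁻¹` and `{1}`. -/
structure IsPositiveCone {H : Type*} [Group H] (P : Set H) : Prop where
  mul_mem : ∀ a ∈ P, ∀ b ∈ P, a * b ∈ P
  one_notMem : (1 : H) ∉ P
  inv_notMem : ∀ a ∈ P, a⁻¹ ∉ P
  exhaust : ∀ a : H, a ∈ P ∨ a⁻¹ ∈ P ∨ a = 1
  conj_mem_iff : ∀ g a : H, g⁻¹ * a * g ∈ P ↔ a ∈ P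

/-- The order attached to a positive cone: `a < b` if and only if `a⁻¹ b ∈ P`. -/
def coneLT {H : Type*} [Group H] (P : Set H) (a b : H) : Prop := a⁻¹ * b ∈ P

/-- A subgroup `C` is convex if `a < g < b` with `a, b ∈ C` forces `g ∈ C`. -/
def IsConvexSubgroup {H : Type*} [Group H] (P : Set H) (C : Subgroup H) : Prop :=
  ∀ a ∈ C, ∀ b ∈ C, ∀ g : H, coneLT P a g → coneLT P g b → g ∈ C

/-- A maximal convex subgroup: proper, convex, and the only convex subgroups containing it are
itself and the whole group. -/
def IsMaximalConvexSubgroup {H : Type*} [Group H] (P : Set H) (C : Subgroup H) : Prop :=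
  IsConvexSubgroup P C ∧ C ≠ ⊤ ∧
    ∀ D : Subgroup H, IsConvexSubgroup P D → C ≤ D → D = C ∨ D = ⊤

/-- A bi-order is standard if every term of the lower central series is convex. -/
def IsStandard {H : Type*} [Group H] (P : Set H) : Prop :=
  ∀ n : ℕ, IsConvexSubgroup P (((⊤ : Subgroup H).lowerCentralSeries n))

/-! ### The fundamental groups -/

/-- `G = π₁(T, x)`, the fundamental group of the once-punctured torus `T` with base point on `∂T`:
the free group on `α` and `β`. -/
abbrev G : Type := FreeGroup (Fin 2)

/-- The generator `α`. -/
def α : G := FreeGroup.of 0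

/-- The generator `β`. -/
def β : G := FreeGroup.of 1

/-- The class `γ₀ = α β α⁻¹ β⁻¹` of the boundary loop of `T`. -/
def boundaryLoop : G := α * β * α⁻¹ * β⁻¹

/-- The abelianization map `p₁ : G → H₁(T; ℤ) = ℤ²`, sending `α` to `(1, 0)` and `β` to `(0, 1)`. -/
def p₁ : G →* Multiplicative (Fin 2 → ℤ) :=
  FreeGroup.lift fun i => Multiplicative.ofAdd (Pi.single i (1 : ℤ))

/-- `p₁` with values in the additive group `ℤ²`. -/
def homologyClass (g : G) : Fin 2 → ℤ := Multiplicative.toAdd (p₁ g)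

/-- The matrix of the map `h₊` induced on `H₁(T; ℤ) = ℤ²` by an automorphism `h` of `G`: its columns
are the classes of `h α` and `h β`. -/
def hPlus (h : MulAut G) : Matrix (Fin 2) (Fin 2) ℤ :=
  Matrix.of fun i j => homologyClass (h (FreeGroup.of j)) i

/-- `h` is the automorphism of `π₁(T, x)` induced by the monodromy of an untwisted hyperbolic
once-punctured torus bundle. The monodromy fixes `∂T` pointwise, so `h` fixes the boundary loop
(and, conversely, all such automorphisms come from homeomorphisms fixing `∂T` pointwise); the bundle
is hyperbolic exactly when `|tr h₊| > 2`, and the eigenvalues of `h₊` are then positive (the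
untwisted case) exactly when `tr h₊ > 2`. -/
structure IsUntwistedHyperbolic (h : MulAut G) : Prop where
  fixes_boundary : h boundaryLoop = boundaryLoop
  two_lt_trace : 2 < (hPlus h).trace

/-- `π₁(M) = G ⋊ ℤ`, where the generator of `ℤ` acts on `G` by `h`. -/
abbrev bundleGroup (h : MulAut G) : Type :=
  SemidirectProduct G (Multiplicative ℤ) (zpowersHom (MulAut G) h)

/-! ### Orders on `ℤ²` -/

/-- `E` is an eigenbasis `(e_λ, e_{1/λ})` of `h₊` acting on `ℝ²`. -/
def IsEigenbasis (h : MulAut G) (lam : ℝ) (E : Module.Basis (Fin 2) ℝ (Fin 2 → ℝ)) : Prop :=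
  ((hPlus h).map (Int.cast : ℤ → ℝ)).mulVec (E 0) = lam • E 0 ∧
    ((hPlus h).map (Int.cast : ℤ → ℝ)).mulVec (E 1) = lam⁻¹ • E 1

/-- The four positive cones of `ℤ²` attached to the vectors `± e_λ`, `± e_{1/λ}`: the vectors `u`
having positive dot product with `s • E i`, where the dot product is the one in the coordinates with
respect to the eigenbasis `E`. -/
def eigenCone (E : Module.Basis (Fin 2) ℝ (Fin 2 → ℝ)) (i : Fin 2) (s : ℤˣ) : Set (Fin 2 → ℤ) :=
  {u | 0 < (((s : ℤ) : ℝ)) * E.repr (fun j => (u j : ℝ)) i}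

/-- The order on `ℤ²` attached to a cone. -/
def prec (Q : Set (Fin 2 → ℤ)) (u v : Fin 2 → ℤ) : Prop := v - u ∈ Q

/-! ### The homology of the abelian cover -/

/-- `G₂ = [G, G]`, the fundamental group of the abelian cover `T̂` of `T`. -/
abbrev G₂ : Subgroup G := commutator G

/-- `H₁(T̂; ℤ) = G₂ / [G₂, G₂]`, written additively. -/
abbrev coverHomology : Type := Additive (Abelianization G₂)

/-- The quotient map `p₂ : G₂ → G₂ / [G₂, G₂] = H₁(T̂; ℤ)`. -/
def p₂ (g : G₂) : coverHomology := Additive.ofMul (Abelianization.of g)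

theorem conj_boundaryLoop_mem (x : G) : x * boundaryLoop * x⁻¹ ∈ G₂ :=
  (inferInstance : (commutator G).Normal).conj_mem _
    (Subgroup.commutator_mem_commutator (Subgroup.mem_top α) (Subgroup.mem_top β)) x

/-- The homology class of the boundary component `γ` of `T̂` with `q(γ) = u = (m, n)`: the component
reached by the lift of `α^m β^n`. These classes are the elements of the basis `𝓑` of `H₁(T̂; ℤ)`,
indexed by `ℤ²` through the bijection `q`. -/
def boundaryClass (u : Fin 2 → ℤ) : coverHomology :=
  p₂ ⟨(α ^ u 0 * β ^ u 1) * boundaryLoop * (α ^ u 0 * β ^ u 1)⁻¹, conj_boundaryLoop_mem _⟩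

/-- `v = ∑ k_γ γ` is non-zero, its largest basis element `max(v)` with a non-zero coefficient is the
one with index `w`, and that coefficient is `k`. -/
def HasLeadingTerm (Q : Set (Fin 2 → ℤ)) (v : coverHomology) (w : Fin 2 → ℤ) (k : ℤ) : Prop :=
  ∃ c : (Fin 2 → ℤ) →₀ ℤ, v = c.sum (fun u a => a • boundaryClass u) ∧
    c w = k ∧ k ≠ 0 ∧ ∀ u, c u ≠ 0 → u ≠ w → prec Q u w

/-- The positive cone `Q₂` of `H₁(T̂; ℤ)`: the leading coefficient is positive. -/
def leadCone (Q : Set (Fin 2 → ℤ)) : Set coverHomology :=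
  {v | ∃ w k, HasLeadingTerm Q v w k ∧ 0 < k}

/-! ### The cone on `G` and the subgroups `C_γ` -/

/-- `Q₃`: the restriction to `[G₂, G₂]` of a positive cone `R` of `π₁(M)`. -/
def restCone (h : MulAut G) (R : Set (bundleGroup h)) : Set G :=
  {g | g ∈ ⁅G₂, G₂⁆ ∧ (SemidirectProduct.inl g : bundleGroup h) ∈ R}

/-- The constructed positive cone `P` of `G`, made of `Q₁`, of `Q₂` (built from the order on `ℤ²` with
cone `Q`) and of `Q₃`. -/
def constructedCone (h : MulAut G) (Q₁ Q : Set (Fin 2 → ℤ)) (R : Set (bundleGroup h)) : Set G :=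
  {g | homologyClass g ∈ Q₁ ∨ (∃ hg : g ∈ G₂, p₂ ⟨g, hg⟩ ∈ leadCone Q) ∨ g ∈ restCone h R}

/-- The restriction of a cone to `G₂`. -/
def restrictG₂ (P : Set G) : Set G₂ := {g | (g : G) ∈ P}

/-- The set `C_γ`, for `γ` with index `u`: the elements `g` of `G₂` with `p₂(g) = 0` or
`max(p₂(g)) ≤ γ`. -/
def convexPiece (Q : Set (Fin 2 → ℤ)) (u : Fin 2 → ℤ) : Set G₂ :=
  {g | p₂ g = 0 ∨ ∃ w k, HasLeadingTerm Q (p₂ g) w k ∧ (w = u ∨ prec Q w u)}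

end PuncturedTorusBundle

open PuncturedTorusBundle

namespace PuncturedTorusBundle

/-! ### The commutator subgroup of `G` -/

/-! Everything is read off the winding numbers `winding g u`, the coordinates of `p₂ g` in the
boundary basis. They are defined on all of `G` as a cocycle, without using freeness of the homology.
On `G₂` they are additive; the conjugates of `boundaryLoop` generate `G₂` and have delta functions
as winding numbers, so the boundary classes span and the winding numbers are dual to them
(`p₂_eq_linearCombination_iff`). Conjugation by `x` translates winding numbers by the class of `x`,
and `h` permutes them by `h₊` (`winding_map`). Each order on `ℤ²` comes from an injective linear
form `ℓ` scaled by `h₊` with a positive factor (`exists_slope`), injective because eigenlines of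
`h₊` contain no non-zero integral vector. Both operations thus preserve leading terms, and `P`,
lexicographic over `G/G₂`, `G₂/[G₂,G₂]`, `[G₂,G₂]`, is invariant under `G` and `h`; a further
lexicographic step extends it to `π₁(M)`. If `x` has class of positive slope, then `1 < γ₀ < [x,
γ₀]`, with `[x, γ₀]` in the third term of the lower central series and `γ₀` outside it, so `P` is
not standard. Finally, slopes are unbounded and convex subgroups form a chain, so the `C_γ` increase
without end and every proper convex subgroup of `G₂` lies in one of them: none is maximal. -/

theorem commute_map_of_forall_of {ι H : Type*} [Group H] (f : FreeGroup ι →* H) (z : H)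
    (hz : ∀ i, Commute z (f (FreeGroup.of i))) (x : FreeGroup ι) : Commute z (f x) := by
  induction x using FreeGroup.induction_on with
  | C1 => simp
  | of i => exact hz i
  | inv_of i hi => rw [map_inv]; exact hi.inv_right
  | mul x y hx hy => rw [map_mul]; exact hx.mul_right hy

theorem homologyClass_one : homologyClass 1 = 0 := by simp [homologyClass]

theorem homologyClass_mul (x y : G) :
    homologyClass (x * y) = homologyClass x + homologyClass y := by simp [homologyClass]

theorem homologyClass_inv (x : G) : homologyClass x⁻¹ = -homologyClass x := by
  simp [homologyClass]

theorem homologyClass_of (i : Fin 2) : homologyClass (FreeGroup.of i) = Pi.single i 1 := by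
  simp [homologyClass, p₁]

theorem homologyClass_conj (x g : G) : homologyClass (x * g * x⁻¹) = homologyClass g := by
  simp [homologyClass_mul, homologyClass_inv]

theorem homologyClass_eq_zero_of_mem {g : G} (hg : g ∈ G₂) : homologyClass g = 0 := by
  have := Abelianization.commutator_subset_ker p₁ hg
  rw [MonoidHom.mem_ker] at this
  simp [homologyClass, this]

theorem homologyClass_α_zpow_mul_β_zpow (u : Fin 2 → ℤ) :
    homologyClass (α ^ u 0 * β ^ u 1) = u := by
  have hα : p₁ α = Multiplicative.ofAdd (Pi.single 0 1) := by simp [p₁, α]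
  have hβ : p₁ β = Multiplicative.ofAdd (Pi.single 1 1) := by simp [p₁, β]
  ext i
  fin_cases i <;> simp [homologyClass, hα, hβ]

theorem abelianization_of_eq (g : G) :
    Abelianization.of g = Abelianization.of (α ^ homologyClass g 0 * β ^ homologyClass g 1) := by
  induction g using FreeGroup.induction_on with
  | C1 => simp [homologyClass_one]
  | of i => fin_cases i <;> simp [homologyClass_of, α, β]
  | inv_of i hi => fin_cases i <;> simp [homologyClass_of, homologyClass_inv, α, β]
  | mul x y hx hy =>
    rw [map_mul, hx, hy]
    simp only [homologyClass_mul, Pi.add_apply, zpow_add, map_mul, map_zpow]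
    exact mul_mul_mul_comm _ _ _ _

theorem mem_commutator_iff (g : G) : g ∈ G₂ ↔ homologyClass g = 0 := by
  refine ⟨homologyClass_eq_zero_of_mem, fun hg => ?_⟩
  have := abelianization_of_eq g
  rw [hg] at this
  simp only [Pi.zero_apply, zpow_zero, mul_one, map_one] at this
  exact (QuotientGroup.eq_one_iff g).mp this

theorem boundaryLoop_mem : boundaryLoop ∈ G₂ := by simpa using conj_boundaryLoop_mem 1

/-- Modulo the normal closure of `γ₀` the two generators commute, so the quotient is abelian. -/
theorem commutator_le_normalClosure : G₂ ≤ Subgroup.normalClosure {boundaryLoop} := by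
  set N := Subgroup.normalClosure ({boundaryLoop} : Set G)
  have key : Commute (QuotientGroup.mk' N α) (QuotientGroup.mk' N β) := by
    rw [← commutatorElement_eq_one_iff_commute, ← map_commutatorElement]
    exact (QuotientGroup.eq_one_iff _).mpr (Subgroup.subset_normalClosure rfl)
  have hgen : ∀ i j : Fin 2, Commute (QuotientGroup.mk' N (FreeGroup.of i))
      (QuotientGroup.mk' N (FreeGroup.of j)) := by
    intro i j
    fin_cases i <;> fin_cases j
    · exact Commute.refl _
    · exact key
    · exact key.symm
    · exact Commute.refl _
  have hall : ∀ x y : G, Commute (QuotientGroup.mk' N x) (QuotientGroup.mk' N y) := fun x y =>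
    commute_map_of_forall_of _ _ (fun j =>
      (commute_map_of_forall_of _ _ (fun i => hgen j i) x).symm) y
  refine Subgroup.commutator_le.mpr fun x _ y _ => ?_
  have := (commutatorElement_eq_one_iff_commute.mpr (hall x y))
  rw [← map_commutatorElement] at this
  exact (QuotientGroup.eq_one_iff _).mp this

/-- Turns normal generation by `γ₀` into an induction principle: additive invariants on `G₂` need
checking only on conjugates of `γ₀`. -/
theorem commutator_induction {p : G → Prop} (one : p 1)
    (mul : ∀ a ∈ G₂, ∀ b ∈ G₂, p a → p b → p (a * b)) (inv : ∀ a ∈ G₂, p a → p a⁻¹)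
    (conj : ∀ x, p (x * boundaryLoop * x⁻¹)) {g : G} (hg : g ∈ G₂) : p g := by
  have hle : Subgroup.normalClosure {boundaryLoop} ≤ G₂ :=
    Subgroup.normalClosure_le_normal (by simpa using boundaryLoop_mem)
  refine Subgroup.closure_induction (k := Group.conjugatesOfSet {boundaryLoop})
    (p := fun g _ => p g) ?_ one (fun a b ha hb => mul a (hle ha) b (hle hb))
    (fun a ha => inv a (hle ha)) (commutator_le_normalClosure hg)
  intro y hy
  simp only [Group.mem_conjugatesOfSet_iff, Set.mem_singleton_iff, exists_eq_left,
    isConj_iff] at hy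
  obtain ⟨c, rfl⟩ := hy
  exact conj c

/-! ### Winding numbers of loops in the abelian cover -/

/-- The permutation `(u, k) ↦ (u + e, k + f u)` of `ℤ² × ℤ`. -/
def shear (e : Fin 2 → ℤ) (f : (Fin 2 → ℤ) → ℤ) : Equiv.Perm ((Fin 2 → ℤ) × ℤ) where
  toFun x := (x.1 + e, x.2 + f x.1)
  invFun x := (x.1 - e, x.2 - f (x.1 - e))
  left_inv x := by simp
  right_inv x := by simp

/-- The crossings of the lifts of `β` with the cut running from the puncture with index `0`. -/
def cutCrossing (i : Fin 2) (u : Fin 2 → ℤ) : ℤ :=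
  if i = 1 ∧ u 1 = -1 ∧ 0 ≤ u 0 then -1 else 0

/-- The action of `G` on `ℤ² × ℤ` that records the crossings with the cut. -/
def crossingAction : G →* Equiv.Perm ((Fin 2 → ℤ) × ℤ) :=
  FreeGroup.lift fun i => shear (Pi.single i 1) (cutCrossing i)

/-- The number of crossings with the cut of the lift of `g` starting at `u`. For `g ∈ G₂` this is
the coefficient of `boundaryClass u` in `p₂ g`. -/
def winding (g : G) (u : Fin 2 → ℤ) : ℤ := (crossingAction g (u, 0)).2

/-- Shears commute with translations of the `ℤ` factor, so the action at height `0` determines it at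
every height. -/
theorem crossingAction_apply (g : G) (x : (Fin 2 → ℤ) × ℤ) :
    crossingAction g x = (x.1 + homologyClass g, x.2 + winding g x.1) := by
  unfold winding
  induction g using FreeGroup.induction_on generalizing x with
  | C1 => simp [homologyClass_one]
  | of i => simp [crossingAction, shear, homologyClass_of]
  | inv_of i hi =>
    rw [map_inv, homologyClass_inv, homologyClass_of]
    simp [crossingAction, shear, Equiv.Perm.inv_def, sub_eq_add_neg]
  | mul a b ha hb =>
    rw [map_mul, Equiv.Perm.mul_apply, Equiv.Perm.mul_apply, homologyClass_mul, hb x, hb (x.1, 0),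
      ha, ha (_, _ + _)]
    ext <;> simp <;> ring

theorem winding_one (u : Fin 2 → ℤ) : winding 1 u = 0 := by simp [winding]

/-- Cocycle rule. Permutations compose from the right, so the lift of `b` is traversed first and `a`
starts at its endpoint. -/
theorem winding_mul (a b : G) (u : Fin 2 → ℤ) :
    winding (a * b) u = winding b u + winding a (u + homologyClass b) := by
  rw [winding, map_mul, Equiv.Perm.mul_apply, crossingAction_apply b, crossingAction_apply a]
  simp

theorem winding_mul_of_mem (a : G) {b : G} (hb : b ∈ G₂) (u : Fin 2 → ℤ) :
    winding (a * b) u = winding a u + winding b u := by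
  rw [winding_mul, homologyClass_eq_zero_of_mem hb, add_zero, add_comm]

theorem winding_inv_of_mem {a : G} (ha : a ∈ G₂) (u : Fin 2 → ℤ) :
    winding a⁻¹ u = -winding a u := by
  have := winding_mul_of_mem a⁻¹ ha u
  rw [inv_mul_cancel, winding_one] at this
  linarith

theorem winding_conj (x : G) {a : G} (ha : a ∈ G₂) (u : Fin 2 → ℤ) :
    winding (x * a * x⁻¹) u = winding a (u - homologyClass x) := by
  have h1 := winding_mul x x⁻¹ u
  rw [mul_inv_cancel, winding_one] at h1
  rw [winding_mul, winding_mul_of_mem x ha]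
  rw [homologyClass_inv, ← sub_eq_add_neg] at *
  linarith

/-- Only the letters `β⁻¹` and `β` can cross the cut; their contributions start one column apart and
cancel except at the tip of the cut. -/
theorem winding_boundaryLoop (u : Fin 2 → ℤ) : winding boundaryLoop u = if u = 0 then 1 else 0 := by
  have h0 : u = 0 ↔ u 0 = 0 ∧ u 1 = 0 := by simp [funext_iff]
  simp only [h0]
  simp only [winding, boundaryLoop, crossingAction, α, β, map_mul, map_inv, FreeGroup.lift_apply_of,
    Equiv.Perm.mul_apply, Equiv.Perm.inv_def, shear, Equiv.coe_fn_mk, Equiv.coe_fn_symm_mk,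
    cutCrossing]
  simp
  split_ifs <;> omega

theorem winding_conj_boundaryLoop (x : G) (u : Fin 2 → ℤ) :
    winding (x * boundaryLoop * x⁻¹) u = if u = homologyClass x then 1 else 0 := by
  rw [winding_conj x boundaryLoop_mem, winding_boundaryLoop]
  simp only [sub_eq_zero]

/-- The winding number around the boundary component with index `u`, as a function on homology. -/
def windingHom (u : Fin 2 → ℤ) : coverHomology →+ ℤ :=
  MonoidHom.toAdditiveLeft <| Abelianization.lift
    { toFun := fun a : G₂ => Multiplicative.ofAdd (winding a u)
      map_one' := by simp [winding_one]
      map_mul' := fun a b => by simp [winding_mul_of_mem _ b.2] }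

theorem windingHom_p₂ (u : Fin 2 → ℤ) (g : G₂) : windingHom u (p₂ g) = winding g u := rfl

theorem windingHom_boundaryClass (u v : Fin 2 → ℤ) :
    windingHom u (boundaryClass v) = if u = v then 1 else 0 := by
  rw [boundaryClass, windingHom_p₂, winding_conj_boundaryLoop, homologyClass_α_zpow_mul_β_zpow]

theorem windingHom_linearCombination (u : Fin 2 → ℤ) (c : (Fin 2 → ℤ) →₀ ℤ) :
    windingHom u (Finsupp.linearCombination ℤ boundaryClass c) = c u := by
  induction c using Finsupp.induction_linear with
  | zero => simp
  | add c d hc hd => rw [map_add, map_add, hc, hd]; rfl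
  | single w k =>
    rw [Finsupp.linearCombination_single, map_zsmul, windingHom_boundaryClass, Finsupp.single_apply]
    simp [eq_comm]

/-! ### The homology of the cover in terms of winding numbers -/

theorem p₂_mul (a b : G₂) : p₂ (a * b) = p₂ a + p₂ b := rfl

theorem p₂_inv (a : G₂) : p₂ a⁻¹ = -p₂ a := rfl

theorem p₂_eq_zero_iff (g : G₂) : p₂ g = 0 ↔ (g : G) ∈ ⁅G₂, G₂⁆ := by
  rw [← Subgroup.map_subtype_commutator]
  refine ⟨fun h => ⟨g, (QuotientGroup.eq_one_iff g).mp h, rfl⟩, ?_⟩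
  rintro ⟨a, ha, hag⟩
  obtain rfl : a = g := Subtype.ext hag
  exact (QuotientGroup.eq_one_iff a).mpr ha

/-- Two elements with the same class differ by an element of `G₂`, and conjugation by it is
invisible in the abelianization of `G₂`. -/
theorem p₂_conj_boundaryLoop (x : G) (hx : x * boundaryLoop * x⁻¹ ∈ G₂) :
    p₂ ⟨x * boundaryLoop * x⁻¹, hx⟩ = boundaryClass (homologyClass x) := by
  set u := homologyClass x with hu
  set t : G := α ^ u 0 * β ^ u 1 with ht
  have hk : x * t⁻¹ ∈ G₂ := by
    rw [mem_commutator_iff, homologyClass_mul, homologyClass_inv, ht,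
      homologyClass_α_zpow_mul_β_zpow, ← hu, add_neg_cancel]
  have : (⟨x * boundaryLoop * x⁻¹, hx⟩ : G₂) =
      ⟨x * t⁻¹, hk⟩ * ⟨t * boundaryLoop * t⁻¹, conj_boundaryLoop_mem t⟩ * ⟨x * t⁻¹, hk⟩⁻¹ := by
    ext
    simp only [Subgroup.coe_mul, Subgroup.coe_inv]
    group
  rw [this, p₂_mul, p₂_mul, p₂_inv, add_comm, neg_add_cancel_left]
  rfl

theorem exists_eq_linearCombination {g : G} (hg : g ∈ G₂) :
    ∃ c : (Fin 2 → ℤ) →₀ ℤ, p₂ ⟨g, hg⟩ = Finsupp.linearCombination ℤ boundaryClass c := by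
  -- The membership proof is quantified inside, so that the induction predicate depends on `g`
  -- alone.
  suffices H : ∃ c : (Fin 2 → ℤ) →₀ ℤ,
      ∀ hg : g ∈ G₂, p₂ ⟨g, hg⟩ = Finsupp.linearCombination ℤ boundaryClass c from
    H.imp fun c hc => hc hg
  refine commutator_induction (p := fun g => ∃ c : (Fin 2 → ℤ) →₀ ℤ,
      ∀ hg : g ∈ G₂, p₂ ⟨g, hg⟩ = Finsupp.linearCombination ℤ boundaryClass c) ?_ ?_ ?_ ?_ hg
  · exact ⟨0, fun _ => by rw [map_zero]; rfl⟩
  · rintro a ha b hb ⟨c, hc⟩ ⟨d, hd⟩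
    exact ⟨c + d, fun _ => by rw [map_add, ← hc ha, ← hd hb]; rfl⟩
  · rintro a ha ⟨c, hc⟩
    exact ⟨-c, fun _ => by rw [map_neg, ← hc ha]; rfl⟩
  · intro x
    exact ⟨Finsupp.single (homologyClass x) 1, fun hg => by
      rw [p₂_conj_boundaryLoop, Finsupp.linearCombination_single, one_smul]⟩

/-- Spanning together with the dual functionals `windingHom` gives unique coordinates. -/
theorem p₂_eq_linearCombination_iff {g : G} (hg : g ∈ G₂) (c : (Fin 2 → ℤ) →₀ ℤ) :
    p₂ ⟨g, hg⟩ = Finsupp.linearCombination ℤ boundaryClass c ↔ ∀ u, winding g u = c u := by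
  have key : ∀ d : (Fin 2 → ℤ) →₀ ℤ, p₂ ⟨g, hg⟩ = Finsupp.linearCombination ℤ boundaryClass d →
      ∀ u, winding g u = d u := fun d hd u => by
    rw [← windingHom_linearCombination u d, ← hd]; rfl
  refine ⟨key c, fun hc => ?_⟩
  obtain ⟨d, hd⟩ := exists_eq_linearCombination hg
  rw [hd, show c = d from Finsupp.ext fun u => (hc u).symm.trans (key d hd u)]

theorem finite_support_winding {g : G} (hg : g ∈ G₂) : (Function.support (winding g)).Finite := by
  obtain ⟨c, hc⟩ := exists_eq_linearCombination hg
  rw [show winding g = c from funext ((p₂_eq_linearCombination_iff hg c).mp hc)]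
  exact c.hasFiniteSupport

theorem p₂_eq_zero_iff_winding (g : G₂) : p₂ g = 0 ↔ ∀ u, winding g u = 0 := by
  simpa using p₂_eq_linearCombination_iff g.2 0

theorem mem_secondDerived_iff (g : G) : g ∈ ⁅G₂, G₂⁆ ↔ g ∈ G₂ ∧ ∀ u, winding g u = 0 := by
  constructor
  · intro hg
    have hg' : g ∈ G₂ := Subgroup.commutator_le_left G₂ G₂ hg
    exact ⟨hg', (p₂_eq_zero_iff_winding ⟨g, hg'⟩).mp ((p₂_eq_zero_iff _).mpr hg)⟩
  · rintro ⟨hg, h⟩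
    exact (p₂_eq_zero_iff ⟨g, hg⟩).mp ((p₂_eq_zero_iff_winding _).mpr h)

/-- An automorphism that fixes the boundary loop and acts on `ℤ²` as `σ`
permutes the winding numbers by `σ`. -/
theorem winding_map (φ : MulAut G) (σ : (Fin 2 → ℤ) → Fin 2 → ℤ) (hσ : Function.Injective σ)
    (hφ : φ boundaryLoop = boundaryLoop) (hφσ : ∀ x, homologyClass (φ x) = σ (homologyClass x))
    {g : G} (hg : g ∈ G₂) (u : Fin 2 → ℤ) : winding (φ g) (σ u) = winding g u := by
  have hmem : ∀ a ∈ G₂, φ a ∈ G₂ := fun a ha => by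
    rw [mem_commutator_iff] at ha ⊢
    rw [hφσ, ha, ← homologyClass_one, ← hφσ, map_one]
  refine commutator_induction (p := fun g => winding (φ g) (σ u) = winding g u) ?_ ?_ ?_ ?_ hg
  · simp [winding_one]
  · intro a ha b hb h1 h2
    rw [map_mul, winding_mul_of_mem _ (hmem b hb), winding_mul_of_mem _ hb, h1, h2]
  · intro a ha h1
    rw [map_inv, winding_inv_of_mem (hmem a ha), winding_inv_of_mem ha, h1]
  · intro x
    rw [map_mul, map_mul, map_inv, hφ, winding_conj_boundaryLoop, winding_conj_boundaryLoop, hφσ]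
    simp only [hσ.eq_iff]

/-! ### The action of the monodromy on `ℤ²` -/

theorem homologyClass_map (h : MulAut G) (x : G) :
    homologyClass (h x) = (hPlus h).mulVec (homologyClass x) := by
  have hof : ∀ i, homologyClass (h (FreeGroup.of i)) =
      (hPlus h).mulVec (homologyClass (FreeGroup.of i)) := fun i => by
    rw [homologyClass_of, Matrix.mulVec_single_one]; rfl
  induction x using FreeGroup.induction_on with
  | C1 => simp [homologyClass_one]
  | of i => exact hof i
  | inv_of i hi => rw [map_inv, homologyClass_inv, homologyClass_inv, hi, Matrix.mulVec_neg]
  | mul x y hx hy =>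
    rw [map_mul, homologyClass_mul, homologyClass_mul, hx, hy, Matrix.mulVec_add]

theorem trace_eq_of_isEigenbasis {h : MulAut G} {lam : ℝ}
    {E : Module.Basis (Fin 2) ℝ (Fin 2 → ℝ)} (hE : IsEigenbasis h lam E) :
    (((hPlus h).trace : ℤ) : ℝ) = lam + lam⁻¹ := by
  set A := (hPlus h).map (Int.cast : ℤ → ℝ) with hA
  have h1 : (((hPlus h).trace : ℤ) : ℝ) = A.trace := by
    simp [hA, Matrix.trace]
  rw [h1, ← Matrix.trace_toLin'_eq, LinearMap.trace_eq_matrix_trace ℝ E, Matrix.trace_fin_two,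
    LinearMap.toMatrix_apply, LinearMap.toMatrix_apply, Matrix.toLin'_apply, Matrix.toLin'_apply,
    hE.1, hE.2]
  simp

/-- For an integer `t > 2` the polynomial `x² - t x + 1` has no rational root. -/
theorem add_inv_ne_intCast {t : ℤ} (ht : 2 < t) {q : ℚ} (hq : q ≠ 0) : q + q⁻¹ ≠ t := by
  intro h
  have hsq : IsSquare (((t ^ 2 - 4 : ℤ)) : ℚ) := by
    refine ⟨q - q⁻¹, ?_⟩
    push_cast
    rw [← h]
    field_simp
    ring
  obtain ⟨s, hs⟩ := Rat.isSquare_intCast_iff.mp hsq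
  -- A square below `t²` is at most `(t - 1)²`, which is less than `t² - 4` once `t ≥ 3`.
  have h1 : |s| < t := abs_lt_of_sq_lt_sq (by nlinarith) (by omega)
  have h2 : |s| * |s| = t ^ 2 - 4 := by rw [abs_mul_abs_self, hs]
  nlinarith [abs_nonneg s]

theorem lam_pos_of_isEigenbasis {h : MulAut G} (hh : IsUntwistedHyperbolic h) {lam : ℝ}
    {E : Module.Basis (Fin 2) ℝ (Fin 2 → ℝ)} (hE : IsEigenbasis h lam E) : 0 < lam := by
  have h1 := trace_eq_of_isEigenbasis hE
  have h2 : (2 : ℝ) < ((hPlus h).trace : ℤ) := by exact_mod_cast hh.two_lt_trace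
  by_contra hneg
  have : lam⁻¹ ≤ 0 := inv_nonpos.mpr (not_lt.mp hneg)
  linarith

/-- A non-zero integral vector is not an eigenvector of `h₊`. -/
theorem eq_zero_of_mulVec_eq_smul {h : MulAut G} (hh : IsUntwistedHyperbolic h) {μ : ℝ}
    (hμ : 0 < μ) (htr : (((hPlus h).trace : ℤ) : ℝ) = μ + μ⁻¹) (u : Fin 2 → ℤ)
    (hu : ((hPlus h).map (Int.cast : ℤ → ℝ)).mulVec (fun j => (u j : ℝ)) =
      μ • fun j => (u j : ℝ)) : u = 0 := by
  by_contra hne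
  obtain ⟨j, hj⟩ := Function.ne_iff.mp hne
  have hj' : (u j : ℝ) ≠ 0 := by exact_mod_cast hj
  -- At a non-zero coordinate of an integral eigenvector the eigenvalue is a ratio of integers.
  set q : ℚ := ((hPlus h).mulVec u j : ℚ) / u j with hq
  have hqμ : (q : ℝ) = μ := by
    have h1 := congrFun hu j
    have h2 : (((hPlus h).mulVec u j : ℤ) : ℝ) = μ * u j := by
      rw [Pi.smul_apply, smul_eq_mul] at h1
      rw [← h1]
      simp [Matrix.mulVec, dotProduct]
    rw [hq]
    push_cast
    rw [h2, mul_div_assoc, div_self hj', mul_one]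
  have hq0 : q ≠ 0 := by
    rintro h0
    rw [h0] at hqμ
    exact hμ.ne (by simpa using hqμ)
  refine add_inv_ne_intCast hh.two_lt_trace hq0 ?_
  rw [← hqμ] at htr
  exact_mod_cast htr.symm

theorem repr_mulVec {h : MulAut G} {lam : ℝ} {E : Module.Basis (Fin 2) ℝ (Fin 2 → ℝ)}
    (hE : IsEigenbasis h lam E) (i : Fin 2) (v : Fin 2 → ℝ) :
    E.repr (((hPlus h).map (Int.cast : ℤ → ℝ)).mulVec v) i = ![lam, lam⁻¹] i * E.repr v i := by
  conv_lhs => rw [← E.sum_repr v]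
  rw [Fin.sum_univ_two, Matrix.mulVec_add, Matrix.mulVec_smul, Matrix.mulVec_smul, hE.1, hE.2]
  fin_cases i <;> simp [mul_comm]

/-- With one coordinate zero, `v` lies on the other eigenline, hence the swapped eigenvalues. -/
theorem mulVec_eq_smul_of_repr_eq_zero {h : MulAut G} {lam : ℝ}
    {E : Module.Basis (Fin 2) ℝ (Fin 2 → ℝ)} (hE : IsEigenbasis h lam E) (i : Fin 2)
    {v : Fin 2 → ℝ} (hv : E.repr v i = 0) :
    ((hPlus h).map (Int.cast : ℤ → ℝ)).mulVec v = ![lam⁻¹, lam] i • v := by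
  apply E.repr.injective
  ext k
  rw [repr_mulVec hE, map_smul, Finsupp.smul_apply, smul_eq_mul]
  fin_cases i <;> fin_cases k <;> simp_all

/-- The order on `ℤ²` with cone `eigenCone E i s` is induced by an injective linear form, which is
an eigenvector of the transpose of `h₊` with positive eigenvalue. -/
theorem exists_slope {h : MulAut G} (hh : IsUntwistedHyperbolic h) {lam : ℝ}
    {E : Module.Basis (Fin 2) ℝ (Fin 2 → ℝ)} (hE : IsEigenbasis h lam E) (i : Fin 2) (s : ℤˣ) :
    ∃ ℓ : (Fin 2 → ℤ) →+ ℝ, Function.Injective ℓ ∧ eigenCone E i s = {u | 0 < ℓ u} ∧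
      ∃ c : ℝ, 0 < c ∧ ∀ u, ℓ ((hPlus h).mulVec u) = c * ℓ u := by
  have hlam := lam_pos_of_isEigenbasis hh hE
  have htr := trace_eq_of_isEigenbasis hE
  have hs : ((s : ℤ) : ℝ) ≠ 0 := by exact_mod_cast s.ne_zero
  let ℓ : (Fin 2 → ℤ) →+ ℝ :=
    { toFun := fun u => ((s : ℤ) : ℝ) * E.repr (fun j => (u j : ℝ)) i
      map_zero' := by
        have : (fun j => (((0 : Fin 2 → ℤ) j : ℤ) : ℝ)) = 0 := by ext; simp
        rw [this]; simp
      map_add' := fun u v => by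
        have : (fun j => (((u + v) j : ℤ) : ℝ)) = (fun j => (u j : ℝ)) + fun j => (v j : ℝ) := by
          ext; simp
        rw [this, map_add, Finsupp.add_apply, mul_add] }
  refine ⟨ℓ, (injective_iff_map_eq_zero ℓ).mpr fun u hu => ?_, rfl, ![lam, lam⁻¹] i, ?_,
    fun u => ?_⟩
  · have h0 : E.repr (fun j => (u j : ℝ)) i = 0 := (mul_eq_zero.mp hu).resolve_left hs
    refine eq_zero_of_mulVec_eq_smul hh (μ := ![lam⁻¹, lam] i) ?_ ?_ u
      (mulVec_eq_smul_of_repr_eq_zero hE i h0)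
    · fin_cases i <;> simp [hlam]
    · rw [htr]
      fin_cases i <;> simp [add_comm]
  · fin_cases i <;> simp [hlam]
  · have : (fun j => (((hPlus h).mulVec u j : ℤ) : ℝ)) =
        ((hPlus h).map (Int.cast : ℤ → ℝ)).mulVec fun j => (u j : ℝ) := by
      ext j; simp [Matrix.mulVec, dotProduct]
    change ((s : ℤ) : ℝ) * E.repr _ i = _ * (((s : ℤ) : ℝ) * E.repr _ i)
    rw [this, repr_mulVec hE]
    ring

/-! ### Functions with positive leading coefficient -/

/-- `f` has a positive leading coefficient, for the order on `ℤ²` induced by `ℓ`. -/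
def LeadPos (ℓ : (Fin 2 → ℤ) →+ ℝ) (f : (Fin 2 → ℤ) → ℤ) : Prop :=
  ∃ w, 0 < f w ∧ ∀ u, ℓ w < ℓ u → f u = 0

section LeadPos

variable {ℓ : (Fin 2 → ℤ) →+ ℝ} {f g : (Fin 2 → ℤ) → ℤ}

theorem exists_leading (ℓ : (Fin 2 → ℤ) →+ ℝ) (hf : (Function.support f).Finite) (h0 : f ≠ 0) :
    ∃ w, f w ≠ 0 ∧ ∀ u, ℓ w < ℓ u → f u = 0 := by
  obtain ⟨w, hw, hmax⟩ := hf.toFinset.exists_max_image ℓ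
    (by rwa [Set.Finite.toFinset_nonempty, Function.support_nonempty_iff])
  refine ⟨w, by simpa using hw, fun u hu => ?_⟩
  by_contra hne
  exact absurd (hmax u (by simpa using hne)) (not_le.mpr hu)

theorem leadPos_or (ℓ : (Fin 2 → ℤ) →+ ℝ) (hf : (Function.support f).Finite) :
    LeadPos ℓ f ∨ LeadPos ℓ (-f) ∨ f = 0 := by
  by_cases h0 : f = 0
  · exact Or.inr (Or.inr h0)
  obtain ⟨w, hw, hmax⟩ := exists_leading ℓ hf h0
  rcases lt_or_gt_of_ne hw with h | h
  · exact Or.inr (Or.inl ⟨w, by simpa using h, fun u hu => by simp [hmax u hu]⟩)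
  · exact Or.inl ⟨w, h, hmax⟩

/-- Injectivity of `ℓ` makes the leading index unique. -/
theorem LeadPos.pos (hℓ : Function.Injective ℓ) (hf : LeadPos ℓ f) {w : Fin 2 → ℤ} (hw : f w ≠ 0)
    (hmax : ∀ u, ℓ w < ℓ u → f u = 0) : 0 < f w := by
  obtain ⟨v, hv, hvmax⟩ := hf
  rcases lt_trichotomy (ℓ v) (ℓ w) with h | h | h
  · exact absurd (hvmax w h) hw
  · rwa [← hℓ h]
  · exact absurd (hmax v h) hv.ne'

theorem LeadPos.add (hℓ : Function.Injective ℓ) (hf : LeadPos ℓ f) (hg : LeadPos ℓ g) :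
    LeadPos ℓ (f + g) := by
  obtain ⟨v, hv, hvmax⟩ := hf
  obtain ⟨w, hw, hwmax⟩ := hg
  rcases lt_trichotomy (ℓ v) (ℓ w) with h | h | h
  · exact ⟨w, by simpa [hvmax w h] using hw, fun u hu => by
      simp [hvmax u (h.trans hu), hwmax u hu]⟩
  · obtain rfl := hℓ h
    exact ⟨v, add_pos hv hw, fun u hu => by simp [hvmax u hu, hwmax u hu]⟩
  · exact ⟨v, by simpa [hwmax v h] using hv, fun u hu => by
      simp [hwmax u (h.trans hu), hvmax u hu]⟩

theorem not_leadPos_zero : ¬ LeadPos ℓ 0 := fun ⟨_, hw, _⟩ => lt_irrefl _ hw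

/-- Invariance under a permutation of the indices that preserves the order. -/
theorem leadPos_comp_iff {σ : (Fin 2 → ℤ) → Fin 2 → ℤ} (hσ : Function.Surjective σ)
    (hmono : ∀ u v, ℓ (σ u) < ℓ (σ v) ↔ ℓ u < ℓ v) (hg : ∀ u, g (σ u) = f u) :
    LeadPos ℓ g ↔ LeadPos ℓ f := by
  constructor
  · rintro ⟨w, hw, hmax⟩
    obtain ⟨v, rfl⟩ := hσ w
    exact ⟨v, by rwa [← hg], fun u hu => by rw [← hg, hmax _ ((hmono v u).mpr hu)]⟩
  · rintro ⟨w, hw, hmax⟩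
    refine ⟨σ w, by rwa [hg], fun u hu => ?_⟩
    obtain ⟨v, rfl⟩ := hσ u
    rw [hg, hmax v ((hmono w v).mp hu)]

end LeadPos

theorem prec_iff (ℓ : (Fin 2 → ℤ) →+ ℝ) (u v : Fin 2 → ℤ) :
    prec {u | 0 < ℓ u} u v ↔ ℓ u < ℓ v := by
  simp [prec]

/-- The coefficients are forced to be the winding numbers, which eliminates the existential. -/
theorem hasLeadingTerm_iff {ℓ : (Fin 2 → ℤ) →+ ℝ} (hℓ : Function.Injective ℓ) (g : G₂)
    (w : Fin 2 → ℤ) (k : ℤ) : HasLeadingTerm {u | 0 < ℓ u} (p₂ g) w k ↔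
      winding g w = k ∧ k ≠ 0 ∧ ∀ u, ℓ w < ℓ u → winding g u = 0 := by
  constructor
  · rintro ⟨c, hc, hcw, hk, hmax⟩
    have hwind := (p₂_eq_linearCombination_iff g.2 c).mp hc
    refine ⟨by rw [hwind, hcw], hk, fun u hu => ?_⟩
    rw [hwind]
    by_contra hne
    have := (prec_iff ℓ u w).mp (hmax u hne (by rintro rfl; exact lt_irrefl _ hu))
    exact lt_asymm this hu
  · rintro ⟨hw, hk, hmax⟩
    obtain ⟨c, hc⟩ := exists_eq_linearCombination g.2
    have hwind := (p₂_eq_linearCombination_iff g.2 c).mp hc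
    refine ⟨c, hc, by rw [← hwind, hw], hk, fun u hu huw => (prec_iff ℓ u w).mpr ?_⟩
    rcases lt_trichotomy (ℓ u) (ℓ w) with h | h | h
    · exact h
    · exact absurd (hℓ h) huw
    · exact absurd ((hwind u).symm.trans (hmax u h)) hu

theorem mem_leadCone_iff {ℓ : (Fin 2 → ℤ) →+ ℝ} (hℓ : Function.Injective ℓ) (g : G₂) :
    p₂ g ∈ leadCone {u | 0 < ℓ u} ↔ LeadPos ℓ (winding g) := by
  constructor
  · rintro ⟨w, k, hk, hpos⟩
    obtain ⟨rfl, -, hmax⟩ := (hasLeadingTerm_iff hℓ g w k).mp hk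
    exact ⟨w, hpos, hmax⟩
  · rintro ⟨w, hpos, hmax⟩
    exact ⟨w, _, (hasLeadingTerm_iff hℓ g w _).mpr ⟨rfl, hpos.ne', hmax⟩, hpos⟩

theorem mem_convexPiece_iff {ℓ : (Fin 2 → ℤ) →+ ℝ} (hℓ : Function.Injective ℓ) (u : Fin 2 → ℤ)
    (g : G₂) : g ∈ convexPiece {u | 0 < ℓ u} u ↔ ∀ v, ℓ u < ℓ v → winding g v = 0 := by
  have hle : ∀ w, (w = u ∨ prec {u | 0 < ℓ u} w u) ↔ ℓ w ≤ ℓ u := fun w => by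
    rw [prec_iff, le_iff_eq_or_lt, hℓ.eq_iff]
  simp only [convexPiece, Set.mem_ofPred_eq, p₂_eq_zero_iff_winding, hasLeadingTerm_iff hℓ, hle]
  constructor
  · rintro (h | ⟨w, k, ⟨-, -, hmax⟩, hw⟩) v hv
    · exact h v
    · exact hmax v (hw.trans_lt hv)
  · intro h
    by_cases h0 : winding g = 0
    · exact Or.inl (congrFun h0)
    · obtain ⟨w, hw, hmax⟩ := exists_leading ℓ (finite_support_winding g.2) h0
      exact Or.inr ⟨w, _, ⟨rfl, hw, hmax⟩, le_of_not_gt fun hlt => hw (h w hlt)⟩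

/-! ### The constructed cone -/

section ConstructedCone

variable {h : MulAut G} {R : Set (bundleGroup h)} {ℓ₁ ℓ : (Fin 2 → ℤ) →+ ℝ}

theorem mem_constructedCone_iff (hℓ : Function.Injective ℓ) (g : G) :
    g ∈ constructedCone h {u | 0 < ℓ₁ u} {u | 0 < ℓ u} R ↔
      0 < ℓ₁ (homologyClass g) ∨ g ∈ G₂ ∧
        (LeadPos ℓ (winding g) ∨ winding g = 0 ∧ (SemidirectProduct.inl g : bundleGroup h) ∈ R) := by
  have h2 : (∃ hg : g ∈ G₂, p₂ ⟨g, hg⟩ ∈ leadCone {u | 0 < ℓ u}) ↔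
      g ∈ G₂ ∧ LeadPos ℓ (winding g) := by
    simp only [mem_leadCone_iff hℓ, exists_prop]
  have h3 : g ∈ restCone h R ↔
      g ∈ G₂ ∧ winding g = 0 ∧ (SemidirectProduct.inl g : bundleGroup h) ∈ R := by
    simp only [restCone, Set.mem_ofPred_eq, mem_secondDerived_iff, funext_iff, Pi.zero_apply,
      and_assoc]
  simp only [constructedCone, Set.mem_ofPred_eq, h2, h3]
  tauto

theorem mem_constructedCone_iff_of_mem (hℓ : Function.Injective ℓ) {g : G} (hg : g ∈ G₂) :
    g ∈ constructedCone h {u | 0 < ℓ₁ u} {u | 0 < ℓ u} R ↔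
      LeadPos ℓ (winding g) ∨ winding g = 0 ∧ (SemidirectProduct.inl g : bundleGroup h) ∈ R := by
  simp [mem_constructedCone_iff hℓ, homologyClass_eq_zero_of_mem hg, hg]

theorem constructedCone_mul_mem (hR : IsPositiveCone R) (hℓ : Function.Injective ℓ) {a b : G}
    (ha : a ∈ constructedCone h {u | 0 < ℓ₁ u} {u | 0 < ℓ u} R)
    (hb : b ∈ constructedCone h {u | 0 < ℓ₁ u} {u | 0 < ℓ u} R) :
    a * b ∈ constructedCone h {u | 0 < ℓ₁ u} {u | 0 < ℓ u} R := by
  rw [mem_constructedCone_iff hℓ] at ha hb ⊢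
  rw [homologyClass_mul, map_add]
  rcases ha with ha | ⟨haG, ha⟩ <;> rcases hb with hb | ⟨hbG, hb⟩
  · exact Or.inl (add_pos ha hb)
  · exact Or.inl (by simpa [homologyClass_eq_zero_of_mem hbG] using ha)
  · exact Or.inl (by simpa [homologyClass_eq_zero_of_mem haG] using hb)
  · refine Or.inr ⟨mul_mem haG hbG, ?_⟩
    rw [show winding (a * b) = winding a + winding b from funext (winding_mul_of_mem a hbG), map_mul]
    rcases ha with ha | ⟨ha0, ha⟩ <;> rcases hb with hb | ⟨hb0, hb⟩
    · exact Or.inl (ha.add hℓ hb)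
    · exact Or.inl (by rwa [hb0, add_zero])
    · exact Or.inl (by rwa [ha0, zero_add])
    · exact Or.inr ⟨by rw [ha0, hb0, add_zero], hR.mul_mem _ ha _ hb⟩

theorem one_notMem_constructedCone (hR : IsPositiveCone R) (hℓ : Function.Injective ℓ) :
    (1 : G) ∉ constructedCone h {u | 0 < ℓ₁ u} {u | 0 < ℓ u} R := by
  rw [mem_constructedCone_iff_of_mem hℓ (one_mem _), show winding 1 = 0 from funext winding_one,
    map_one]
  rintro (h | ⟨-, h⟩)
  · exact not_leadPos_zero h
  · exact hR.one_notMem h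

theorem constructedCone_exhaust (hR : IsPositiveCone R) (hℓ₁ : Function.Injective ℓ₁)
    (hℓ : Function.Injective ℓ) (a : G) :
    a ∈ constructedCone h {u | 0 < ℓ₁ u} {u | 0 < ℓ u} R ∨
      a⁻¹ ∈ constructedCone h {u | 0 < ℓ₁ u} {u | 0 < ℓ u} R ∨ a = 1 := by
  by_cases haG : a ∈ G₂
  · rw [mem_constructedCone_iff_of_mem hℓ haG, mem_constructedCone_iff_of_mem hℓ (inv_mem haG),
      show winding a⁻¹ = -winding a from funext (winding_inv_of_mem haG), map_inv]
    rcases leadPos_or ℓ (finite_support_winding haG) with h1 | h1 | h1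
    · exact Or.inl (Or.inl h1)
    · exact Or.inr (Or.inl (Or.inl h1))
    · rcases hR.exhaust (SemidirectProduct.inl a) with h2 | h2 | h2
      · exact Or.inl (Or.inr ⟨h1, h2⟩)
      · exact Or.inr (Or.inl (Or.inr ⟨by rw [h1, neg_zero], h2⟩))
      · exact Or.inr (Or.inr (SemidirectProduct.inl_injective (h2.trans (map_one _).symm)))
  · simp only [mem_constructedCone_iff hℓ, homologyClass_inv, map_neg]
    have hne : ℓ₁ (homologyClass a) ≠ 0 := fun h0 =>
      haG ((mem_commutator_iff a).mpr ((injective_iff_map_eq_zero ℓ₁).mp hℓ₁ _ h0))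
    rcases lt_or_gt_of_ne hne with h1 | h1
    · exact Or.inr (Or.inl (Or.inl (neg_pos.mpr h1)))
    · exact Or.inl (Or.inl h1)

/-- Conjugation fixes the class in `ℤ²`, translates the winding numbers, which respects `ℓ`, and
preserves `R`. -/
theorem constructedCone_conj_iff (hR : IsPositiveCone R) (hℓ : Function.Injective ℓ) (x a : G) :
    x * a * x⁻¹ ∈ constructedCone h {u | 0 < ℓ₁ u} {u | 0 < ℓ u} R ↔
      a ∈ constructedCone h {u | 0 < ℓ₁ u} {u | 0 < ℓ u} R := by
  have hG : x * a * x⁻¹ ∈ G₂ ↔ a ∈ G₂ := by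
    rw [mem_commutator_iff, mem_commutator_iff, homologyClass_conj]
  by_cases haG : a ∈ G₂
  · have hR' : (SemidirectProduct.inl (x * a * x⁻¹) : bundleGroup h) ∈ R ↔
        (SemidirectProduct.inl a : bundleGroup h) ∈ R := by
      rw [← hR.conj_mem_iff (SemidirectProduct.inl x⁻¹) (SemidirectProduct.inl a)]
      simp
    have hw : ∀ u, winding (x * a * x⁻¹) (u + homologyClass x) = winding a u := fun u => by
      rw [winding_conj x haG, add_sub_cancel_right]
    have h0 : winding (x * a * x⁻¹) = 0 ↔ winding a = 0 := by
      simp only [funext_iff, ← hw]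
      exact ⟨fun H u => H _, fun H u => by simpa using H (u - homologyClass x)⟩
    rw [mem_constructedCone_iff_of_mem hℓ (hG.mpr haG), mem_constructedCone_iff_of_mem hℓ haG, hR',
      h0, leadPos_comp_iff (add_right_surjective (homologyClass x)) (by simp) hw]
  · simp only [mem_constructedCone_iff hℓ, homologyClass_conj, hG, haG, false_and]

theorem isPositiveCone_constructedCone (hR : IsPositiveCone R) (hℓ₁ : Function.Injective ℓ₁)
    (hℓ : Function.Injective ℓ) :
    IsPositiveCone (constructedCone h {u | 0 < ℓ₁ u} {u | 0 < ℓ u} R) where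
  mul_mem _ ha _ hb := constructedCone_mul_mem hR hℓ ha hb
  one_notMem := one_notMem_constructedCone hR hℓ
  inv_notMem a ha ha' := one_notMem_constructedCone hR hℓ
    (mul_inv_cancel a ▸ constructedCone_mul_mem hR hℓ ha ha')
  exhaust := constructedCone_exhaust hR hℓ₁ hℓ
  conj_mem_iff g a := by simpa using constructedCone_conj_iff hR hℓ g⁻¹ a

theorem constructedCone_map_iff (hR : IsPositiveCone R) (hℓ : Function.Injective ℓ)
    (hfix : h boundaryLoop = boundaryLoop)
    (hscale₁ : ∃ c : ℝ, 0 < c ∧ ∀ u, ℓ₁ ((hPlus h).mulVec u) = c * ℓ₁ u)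
    (hscale : ∃ c : ℝ, 0 < c ∧ ∀ u, ℓ ((hPlus h).mulVec u) = c * ℓ u) (g : G) :
    h g ∈ constructedCone h {u | 0 < ℓ₁ u} {u | 0 < ℓ u} R ↔
      g ∈ constructedCone h {u | 0 < ℓ₁ u} {u | 0 < ℓ u} R := by
  obtain ⟨c₁, hc₁, hs₁⟩ := hscale₁
  obtain ⟨c, hc, hs⟩ := hscale
  have hinj : Function.Injective (hPlus h).mulVec := fun u v huv => hℓ <| by
    have := congrArg ℓ huv
    rw [hs, hs] at this
    exact mul_left_cancel₀ hc.ne' this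
  have hsurj : Function.Surjective (hPlus h).mulVec := fun u => by
    obtain ⟨y, hy⟩ := h.surjective (α ^ u 0 * β ^ u 1)
    exact ⟨homologyClass y, by rw [← homologyClass_map, hy, homologyClass_α_zpow_mul_β_zpow]⟩
  have hmono : ∀ u v, ℓ ((hPlus h).mulVec u) < ℓ ((hPlus h).mulVec v) ↔ ℓ u < ℓ v := fun u v => by
    rw [hs, hs, mul_lt_mul_iff_right₀ hc]
  have hG : h g ∈ G₂ ↔ g ∈ G₂ := by
    rw [mem_commutator_iff, mem_commutator_iff, homologyClass_map]
    exact ⟨fun h0 => hinj (h0.trans (Matrix.mulVec_zero _).symm), fun h0 => by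
      rw [h0, Matrix.mulVec_zero]⟩
  by_cases hg : g ∈ G₂
  · have hR' : (SemidirectProduct.inl (h g) : bundleGroup h) ∈ R ↔
        (SemidirectProduct.inl g : bundleGroup h) ∈ R := by
      -- In `π₁(M)` the automorphism `h` is conjugation by the stable letter, so conjugation
      -- invariance of `R` gives `h`-invariance of `Q₃`.
      have h1 := SemidirectProduct.inl_aut (φ := zpowersHom (MulAut G) h)
        (Multiplicative.ofAdd 1) g
      rw [zpowersHom_apply, toAdd_ofAdd, zpow_one] at h1
      rw [h1, ← hR.conj_mem_iff (SemidirectProduct.inr (Multiplicative.ofAdd 1)⁻¹)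
        (SemidirectProduct.inl g)]
      simp
    have hw := winding_map h _ hinj hfix (homologyClass_map h) hg
    have h0 : winding (h g) = 0 ↔ winding g = 0 := by
      simp only [funext_iff, ← hw]
      exact ⟨fun H u => H _, fun H u => by obtain ⟨v, rfl⟩ := hsurj u; exact H v⟩
    rw [mem_constructedCone_iff_of_mem hℓ (hG.mpr hg), mem_constructedCone_iff_of_mem hℓ hg, hR',
      h0, leadPos_comp_iff hsurj hmono hw]
  · simp only [mem_constructedCone_iff hℓ, homologyClass_map, hG, hg, false_and, hs₁,
      mul_pos_iff_of_pos_left hc₁]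

end ConstructedCone

/-! ### Extending invariant cones to the bundle group -/

/-- The lexicographic extension of a cone of `G` to `G ⋊ ℤ`. -/
def lexCone (h : MulAut G) (P : Set G) : Set (bundleGroup h) :=
  {x | 0 < Multiplicative.toAdd x.right ∨ x.right = 1 ∧ x.left ∈ P}

theorem zpow_map_mem_iff {h : MulAut G} {P : Set G} (hP : ∀ g, h g ∈ P ↔ g ∈ P) (n : ℤ) (g : G) :
    (h ^ n) g ∈ P ↔ g ∈ P := by
  let S : Subgroup (MulAut G) :=
    { carrier := {φ | ∀ g, φ g ∈ P ↔ g ∈ P}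
      mul_mem' := fun {a b} ha hb g => by rw [MulAut.mul_apply, ha, hb]
      one_mem' := fun g => Iff.rfl
      inv_mem' := fun {a} ha g => by rw [← ha (a⁻¹ g), MulAut.apply_inv_self] }
  exact S.zpow_mem (show h ∈ S from hP) n g

/-- The quotient `ℤ` is abelian, so conjugation fixes the `ℤ` component; on `G` it acts by an inner
automorphism followed by a power of `h`, both preserving `P`. -/
theorem isPositiveCone_lexCone {h : MulAut G} {P : Set G} (hP : IsPositiveCone P)
    (hh : ∀ g, h g ∈ P ↔ g ∈ P) : IsPositiveCone (lexCone h P) := by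
  have hact : ∀ (n : Multiplicative ℤ) (g : G), zpowersHom (MulAut G) h n g ∈ P ↔ g ∈ P :=
    fun n g => by rw [zpowersHom_apply]; exact zpow_map_mem_iff hh _ g
  have hmul : ∀ a ∈ lexCone h P, ∀ b ∈ lexCone h P, a * b ∈ lexCone h P := by
    rintro a (ha | ⟨ha, ha'⟩) b (hb | ⟨hb, hb'⟩)
    · exact Or.inl (by rw [SemidirectProduct.mul_right, toAdd_mul]; exact add_pos ha hb)
    · exact Or.inl (by rwa [SemidirectProduct.mul_right, hb, mul_one])
    · exact Or.inl (by rwa [SemidirectProduct.mul_right, ha, one_mul])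
    · refine Or.inr ⟨by rw [SemidirectProduct.mul_right, ha, hb, one_mul], ?_⟩
      rw [SemidirectProduct.mul_left]
      exact hP.mul_mem _ ha' _ ((hact _ _).mpr hb')
  have hone : (1 : bundleGroup h) ∉ lexCone h P := by
    rintro (h1 | ⟨-, h1⟩)
    · exact lt_irrefl _ h1
    · exact hP.one_notMem h1
  refine ⟨hmul, hone, fun a ha ha' => hone (mul_inv_cancel a ▸ hmul a ha _ ha'), fun a => ?_,
    fun g a => ?_⟩
  · rcases lt_trichotomy (Multiplicative.toAdd a.right) 0 with h1 | h1 | h1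
    · exact Or.inr (Or.inl (Or.inl (by simpa using h1)))
    · have h1' : a.right = 1 := h1
      rcases hP.exhaust a.left with h2 | h2 | h2
      · exact Or.inl (Or.inr ⟨h1', h2⟩)
      · refine Or.inr (Or.inl (Or.inr ⟨by simp [h1'], ?_⟩))
        rw [SemidirectProduct.inv_left]
        exact (hact _ _).mpr h2
      · exact Or.inr (Or.inr (SemidirectProduct.ext h2 h1'))
    · exact Or.inl (Or.inl h1)
  · have hright : (g⁻¹ * a * g).right = a.right := by
      rw [SemidirectProduct.mul_right, SemidirectProduct.mul_right, SemidirectProduct.inv_right,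
        mul_comm, mul_inv_cancel_left]
    simp only [lexCone, Set.mem_ofPred_eq, hright]
    refine or_congr Iff.rfl (and_congr_right fun ha => ?_)
    have hleft : (g⁻¹ * a * g).left =
        zpowersHom (MulAut G) h g.right⁻¹ (g.left⁻¹ * a.left * g.left) := by
      simp [SemidirectProduct.mul_left, SemidirectProduct.mul_right, ha]
    rw [hleft, hact, hP.conj_mem_iff]

theorem inl_mem_lexCone_iff (h : MulAut G) (P : Set G) (g : G) :
    (SemidirectProduct.inl g : bundleGroup h) ∈ lexCone h P ↔ g ∈ P := by
  simp [lexCone]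

/-! ### Convex subgroups -/

theorem IsPositiveCone.restrictG₂ {P : Set G} (hP : IsPositiveCone P) :
    IsPositiveCone (restrictG₂ P) where
  mul_mem a ha b hb := hP.mul_mem a ha b hb
  one_notMem := hP.one_notMem
  inv_notMem a ha := hP.inv_notMem a ha
  exhaust a := by
    rcases hP.exhaust a with h | h | h
    · exact Or.inl h
    · exact Or.inr (Or.inl h)
    · exact Or.inr (Or.inr (Subtype.ext h))
  conj_mem_iff g a := hP.conj_mem_iff g a

/-- The convex subgroups of a bi-ordered group are totally ordered by inclusion. -/
theorem IsConvexSubgroup.le_of_not_le {H : Type*} [Group H] {P : Set H} (hP : IsPositiveCone P)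
    {C D : Subgroup H} (hC : IsConvexSubgroup P C) (hD : IsConvexSubgroup P D) (hDC : ¬ D ≤ C) :
    C ≤ D := by
  obtain ⟨d, hd, hdC⟩ : ∃ d ∈ D, d ∉ C := SetLike.not_le_iff_exists.mp hDC
  wlog hdP : d ∈ P generalizing d
  · rcases hP.exhaust d with h | h | rfl
    · exact absurd h hdP
    · exact this d⁻¹ (inv_mem hd) (by simpa using hdC) h
    · exact absurd (one_mem C) hdC
  -- Either `1 < c < d`, and convexity of `D` applies, or `1 < d < c`, which would put `d` in `C`.
  have key : ∀ c ∈ C, c ∈ P → c ∈ D := by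
    intro c hc hcP
    refine hD 1 (one_mem D) d hd c (by simpa [coneLT] using hcP) ?_
    rcases hP.exhaust (c⁻¹ * d) with h | h | h
    · exact h
    · refine absurd (hC 1 (one_mem C) c hc d (by simpa [coneLT] using hdP) ?_) hdC
      simpa [coneLT] using h
    · exact absurd (by rwa [← inv_mul_eq_one.mp h]) hdC
  intro c hc
  rcases hP.exhaust c with h | h | rfl
  · exact key c hc h
  · exact inv_inv c ▸ inv_mem (key c⁻¹ (inv_mem hc) h)
  · exact one_mem D

/-! ### Failure of standardness -/

theorem boundaryLoop_notMem_lowerCentralSeries :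
    boundaryLoop ∉ (⊤ : Subgroup G).lowerCentralSeries 2 := by
  -- The dihedral group of order 8 is nilpotent of class 2: `γ₀` goes to the central element `r 2 ≠
  -- 1`, while index `2` of the series, counted from `0`, is `[[G, G], G]` and dies.
  let f : G →* DihedralGroup 4 :=
    FreeGroup.lift ![DihedralGroup.r 1, DihedralGroup.sr 0]
  have hf : f boundaryLoop = DihedralGroup.r 2 := by
    simp only [boundaryLoop, α, β, f, map_mul, map_inv, FreeGroup.lift_apply_of]
    decide
  have hcent : ∀ x : DihedralGroup 4, x * DihedralGroup.r 2 = DihedralGroup.r 2 * x := by decide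
  have hG₂ : ∀ g ∈ G₂, ∀ x, Commute x (f g) := fun g hg x => by
    refine commutator_induction (p := fun g => Commute x (f g)) ?_ ?_ ?_ ?_ hg
    · simp
    · intro a _ b _ ha hb
      rw [map_mul]
      exact ha.mul_right hb
    · intro a _ ha
      rw [map_inv]
      exact ha.inv_right
    · intro y
      rw [map_mul, map_mul, map_inv, hf, hcent, mul_inv_cancel_right]
      exact hcent x
  have hker : (⊤ : Subgroup G).lowerCentralSeries 2 ≤ f.ker := by
    rw [Subgroup.lowerCentralSeries_succ, Subgroup.top_lowerCentralSeries_one,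
      Subgroup.commutator_le]
    intro a ha b _
    rw [MonoidHom.mem_ker, map_commutatorElement, commutatorElement_eq_one_iff_commute]
    exact (hG₂ a ha _).symm
  intro hmem
  have h1 := hker hmem
  rw [MonoidHom.mem_ker, hf] at h1
  exact absurd h1 (by decide)

theorem commutator_conj_boundaryLoop_mem (x : G) :
    x * boundaryLoop * x⁻¹ * boundaryLoop⁻¹ ∈ (⊤ : Subgroup G).lowerCentralSeries 2 := by
  rw [Subgroup.lowerCentralSeries_succ, Subgroup.top_lowerCentralSeries_one,
    Subgroup.commutator_comm]
  exact Subgroup.commutator_mem_commutator (Subgroup.mem_top x) boundaryLoop_mem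

theorem exists_slope_pos {ℓ : (Fin 2 → ℤ) →+ ℝ} (hℓ : Function.Injective ℓ) : ∃ u, 0 < ℓ u := by
  have hne : ℓ (Pi.single 0 1) ≠ 0 := fun h0 => by
    simpa using (injective_iff_map_eq_zero ℓ).mp hℓ _ h0
  rcases lt_or_gt_of_ne hne with h | h
  · exact ⟨-Pi.single 0 1, by rw [map_neg]; exact neg_pos.mpr h⟩
  · exact ⟨_, h⟩

section

variable {h : MulAut G} {R : Set (bundleGroup h)} {ℓ₁ ℓ : (Fin 2 → ℤ) →+ ℝ}

/-- The element `γ₀⁻¹[x, γ₀]` has coefficient `1` at the class of `x` and `-2` at `0`; the former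
leads when that class has positive slope. So `γ₀` lies strictly between `1` and `[x, γ₀]`. -/
theorem not_isStandard_constructedCone (hℓ : Function.Injective ℓ) :
    ¬ IsStandard (constructedCone h {u | 0 < ℓ₁ u} {u | 0 < ℓ u} R) := by
  intro hst
  obtain ⟨u, hu⟩ := exists_slope_pos hℓ
  obtain ⟨x, rfl⟩ : ∃ x, homologyClass x = u := ⟨_, homologyClass_α_zpow_mul_β_zpow u⟩
  have hx0 : homologyClass x ≠ 0 := fun h0 => by simp [h0] at hu
  have hmem : x * boundaryLoop * x⁻¹ ∈ G₂ := conj_boundaryLoop_mem x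
  have hinv := inv_mem boundaryLoop_mem
  refine boundaryLoop_notMem_lowerCentralSeries (hst 2 1 (one_mem _) _
    (commutator_conj_boundaryLoop_mem x) boundaryLoop ?_ ?_)
  · rw [coneLT, inv_one, one_mul, mem_constructedCone_iff_of_mem hℓ boundaryLoop_mem]
    refine Or.inl ⟨0, by simp [winding_boundaryLoop], fun v hv => ?_⟩
    rw [winding_boundaryLoop, if_neg]
    rintro rfl
    exact lt_irrefl _ hv
  · rw [coneLT, mem_constructedCone_iff_of_mem hℓ (mul_mem hinv (mul_mem hmem hinv))]
    refine Or.inl ⟨homologyClass x, ?_, fun v hv => ?_⟩ <;>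
      rw [winding_mul_of_mem _ (mul_mem hmem hinv), winding_mul_of_mem _ hinv,
        winding_conj_boundaryLoop, winding_inv_of_mem boundaryLoop_mem, winding_boundaryLoop]
    · simp [hx0]
    · have h1 : v ≠ homologyClass x := by
        rintro rfl
        exact lt_irrefl _ hv
      have h2 : v ≠ 0 := by
        rintro rfl
        rw [map_zero] at hv
        exact lt_asymm hu hv
      simp [h1, h2]

/-- The subgroup of elements of `G₂` with no winding around the components above `u`. -/
def windingBelow (ℓ : (Fin 2 → ℤ) →+ ℝ) (u : Fin 2 → ℤ) : Subgroup G₂ where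
  carrier := {g | ∀ v, ℓ u < ℓ v → winding g v = 0}
  one_mem' _ _ := winding_one _
  mul_mem' {a b} ha hb v hv := by
    rw [Subgroup.coe_mul, winding_mul_of_mem _ b.2, ha v hv, hb v hv, add_zero]
  inv_mem' {a} ha v hv := by rw [Subgroup.coe_inv, winding_inv_of_mem a.2, ha v hv, neg_zero]

theorem mem_windingBelow {u : Fin 2 → ℤ} {g : G₂} :
    g ∈ windingBelow ℓ u ↔ ∀ v, ℓ u < ℓ v → winding g v = 0 := Iff.rfl

theorem coe_windingBelow (hℓ : Function.Injective ℓ) (u : Fin 2 → ℤ) :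
    (windingBelow ℓ u : Set G₂) = convexPiece {u | 0 < ℓ u} u :=
  Set.ext fun g => (mem_convexPiece_iff hℓ u g).symm

/-- Elements of the subgroup do not affect coefficients above `u`. If `g` led above `u`, then `a⁻¹g`
and `g⁻¹b` would have opposite leading coefficients there, yet both are positive. -/
theorem isConvexSubgroup_windingBelow (hℓ : Function.Injective ℓ) (u : Fin 2 → ℤ) :
    IsConvexSubgroup (restrictG₂ (constructedCone h {u | 0 < ℓ₁ u} {u | 0 < ℓ u} R))
      (windingBelow ℓ u) := by
  intro a ha b hb g hag hgb
  by_contra hg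
  obtain ⟨v, huv, hv⟩ : ∃ v, ℓ u < ℓ v ∧ winding g v ≠ 0 := by
    simpa [mem_windingBelow] using hg
  obtain ⟨w, hw, hmax⟩ := exists_leading ℓ (finite_support_winding g.2)
    (fun h0 => hv (congrFun h0 v))
  have huw : ℓ u < ℓ w := huv.trans_le (le_of_not_gt fun hlt => hv (hmax v hlt))
  have hwind₁ : ∀ z, ℓ u < ℓ z → winding (a⁻¹ * g : G₂) z = winding g z := fun z hz => by
    rw [Subgroup.coe_mul, winding_mul_of_mem _ g.2, (inv_mem ha : a⁻¹ ∈ windingBelow ℓ u) z hz,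
      zero_add]
  have hwind₂ : ∀ z, ℓ u < ℓ z → winding (g⁻¹ * b : G₂) z = -winding g z := fun z hz => by
    rw [Subgroup.coe_mul, winding_mul_of_mem _ b.2, hb z hz, add_zero, Subgroup.coe_inv,
      winding_inv_of_mem g.2]
  have hlead : ∀ c : G₂, (c : G) ∈ constructedCone h {u | 0 < ℓ₁ u} {u | 0 < ℓ u} R →
      winding c w ≠ 0 → (∀ z, ℓ w < ℓ z → winding c z = 0) → 0 < winding c w := by
    intro c hc hcw hcmax
    rcases (mem_constructedCone_iff_of_mem hℓ c.2).mp hc with h1 | ⟨h1, -⟩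
    · exact h1.pos hℓ hcw hcmax
    · exact absurd (congrFun h1 w) hcw
  have h1 := hlead _ hag (by rwa [hwind₁ w huw]) fun z hz => by
    rw [hwind₁ z (huw.trans hz), hmax z hz]
  have h2 := hlead _ hgb (by rwa [hwind₂ w huw, neg_ne_zero]) fun z hz => by
    rw [hwind₂ z (huw.trans hz), hmax z hz, neg_zero]
  rw [hwind₁ w huw] at h1
  rw [hwind₂ w huw] at h2
  linarith

theorem windingBelow_lt {u v : Fin 2 → ℤ} (huv : ℓ u < ℓ v) :
    windingBelow ℓ u < windingBelow ℓ v := by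
  refine SetLike.lt_iff_le_and_exists.mpr ⟨fun g hg w hw => hg w (huv.trans hw), ?_⟩
  have hx := homologyClass_α_zpow_mul_β_zpow v
  refine ⟨⟨_, conj_boundaryLoop_mem (α ^ v 0 * β ^ v 1)⟩, fun w hw => ?_, fun hmem => ?_⟩
  · rw [winding_conj_boundaryLoop, hx, if_neg]
    rintro rfl
    exact lt_irrefl _ hw
  · have := hmem v huv
    rw [winding_conj_boundaryLoop, hx, if_pos rfl] at this
    exact one_ne_zero this

theorem exists_windingBelow_lt (hℓ : Function.Injective ℓ) (u : Fin 2 → ℤ) :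
    ∃ v, windingBelow ℓ u < windingBelow ℓ v := by
  obtain ⟨w, hw⟩ := exists_slope_pos hℓ
  exact ⟨u + w, windingBelow_lt (by rw [map_add]; linarith)⟩

theorem exists_mem_windingBelow (ℓ : (Fin 2 → ℤ) →+ ℝ) (g : G₂) : ∃ u, g ∈ windingBelow ℓ u := by
  by_cases h0 : winding g = 0
  · exact ⟨0, fun v _ => congrFun h0 v⟩
  · obtain ⟨w, -, hmax⟩ := exists_leading ℓ (finite_support_winding g.2) h0
    exact ⟨w, hmax⟩

theorem not_exists_isMaximalConvexSubgroup (hR : IsPositiveCone R) (hℓ₁ : Function.Injective ℓ₁)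
    (hℓ : Function.Injective ℓ) :
    ¬ ∃ C : Subgroup G₂, IsMaximalConvexSubgroup
      (restrictG₂ (constructedCone h {u | 0 < ℓ₁ u} {u | 0 < ℓ u} R)) C := by
  rintro ⟨C, hC, hCtop, hmax⟩
  obtain ⟨g, hg⟩ : ∃ g, g ∉ C := by
    by_contra! hall
    exact hCtop ((Subgroup.eq_top_iff' C).mpr hall)
  obtain ⟨u, hu⟩ := exists_mem_windingBelow ℓ g
  have hle : C ≤ windingBelow ℓ u :=
    hC.le_of_not_le (isPositiveCone_constructedCone hR hℓ₁ hℓ).restrictG₂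
      (isConvexSubgroup_windingBelow hℓ u) fun hle => hg (hle hu)
  -- Two steps up are needed: `v` gives a convex subgroup strictly larger than `C`, and `w` shows
  -- that it is still proper.
  obtain ⟨v, huv⟩ := exists_windingBelow_lt hℓ u
  obtain ⟨w, hvw⟩ := exists_windingBelow_lt hℓ v
  rcases hmax _ (isConvexSubgroup_windingBelow hℓ v) (hle.trans huv.le) with h1 | h1
  · exact (hle.trans_lt huv).ne' h1
  · exact (hvw.trans_le le_top).ne h1

end

end PuncturedTorusBundle

theorem corollary4
    (h : MulAut G) (hh : IsUntwistedHyperbolic h)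
    (lam : ℝ) (E : Module.Basis (Fin 2) ℝ (Fin 2 → ℝ)) (hE : IsEigenbasis h lam E)
    (i₁ i₂ : Fin 2) (s₁ s₂ : ℤˣ)
    (R : Set (bundleGroup h)) (hR : IsPositiveCone R)
    (Q : Set (Fin 2 → ℤ)) (hQ : Q = eigenCone E i₂ s₂)
    (P : Set G) (hP : P = constructedCone h (eigenCone E i₁ s₁) Q R) :
    -- `P` is a positive cone of `G`, it extends to one of `π₁(M)`, and it is not standard
    IsPositiveCone P ∧
    (∃ P' : Set (bundleGroup h), IsPositiveCone P' ∧
      ∀ g : G, (SemidirectProduct.inl g : bundleGroup h) ∈ P' ↔ g ∈ P) ∧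
    ¬ IsStandard P ∧
    -- `G₂` has no maximal convex subgroup
    (¬ ∃ C : Subgroup G₂, IsMaximalConvexSubgroup (restrictG₂ P) C) ∧
    -- `G₂` is the increasing union of the proper convex subgroups `C_γ`
    (∃ C : (Fin 2 → ℤ) → Subgroup G₂,
      (∀ u, (C u : Set G₂) = convexPiece Q u) ∧
      (∀ u, IsConvexSubgroup (restrictG₂ P) (C u)) ∧
      (∀ u v, prec Q u v → C u < C v) ∧
      (∀ u, C u < ⊤) ∧
      (⋃ u, (C u : Set G₂)) = Set.univ) := by
  obtain ⟨ℓ₁, hℓ₁, hQ₁, hscale₁⟩ := exists_slope hh hE i₁ s₁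
  obtain ⟨ℓ, hℓ, hQ₂, hscale⟩ := exists_slope hh hE i₂ s₂
  rw [hQ₂] at hQ
  subst hQ
  rw [hQ₁] at hP
  subst hP
  have hcone := isPositiveCone_constructedCone hR hℓ₁ hℓ
  refine ⟨hcone, ⟨lexCone h _, isPositiveCone_lexCone hcone
      (constructedCone_map_iff hR hℓ hh.fixes_boundary hscale₁ hscale), inl_mem_lexCone_iff h _⟩,
    not_isStandard_constructedCone hℓ, not_exists_isMaximalConvexSubgroup hR hℓ₁ hℓ,
    windingBelow ℓ, coe_windingBelow hℓ, isConvexSubgroup_windingBelow hℓ,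
    fun u v huv => windingBelow_lt ((prec_iff ℓ u v).mp huv), fun u => ?_,
    Set.eq_univ_of_forall fun g => Set.mem_iUnion.mpr (exists_mem_windingBelow ℓ g)⟩
  obtain ⟨v, huv⟩ := exists_windingBelow_lt hℓ u
  exact huv.trans_le le_top
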